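/- Let $k \ge 2$ and $t_L, t_R \in \mathbb{N}$. There are $n = 2k$ parties, split into two disjoint sides $L$ and $R$ with $|L| = |R| = k$. Every party holds as input a preference list, i.e. an ordering of all $k$ parties of the opposite side, and prefers every one of these parties to being alone. The parties run a deterministic synchronous round-based protocol over bidirectional authenticated channels (the receiver of a message knows its sender), without signatures or any other cryptographic setup. The network is one-sided: every two distinct parties are joined by a channel, except pairs of parties that are both in $L$. An adversary may corrupt up to $t_L$ parties of $L$ and up to $t_R$ parties of $R$; from its corruption on, a party is byzantine and sends arbitrary messages. A party is honest if it never becomes byzantine. The adversary is either adaptive (it may corrupt parties at any point of the execution) or static (it chooses the corrupted parties at the beginning). A protocol achieves byzantine stable matching ($\mathsf{bSM}$) with respect to $t_L$ and $t_R$ if every execution, for all inputs and all behaviours of such an adversary, satisfies the following. - Termination: every honest party outputs either a party on the opposite side or nobody. - Symmetry: for honest parties $u, v$, if $u$ outputs $v$, then $v$ outputs $u$. - Stability: there is no blocking pair of honest parties, i.e. no two honest parties on opposite sides each of which strictly prefers the other to its own output. - Non-competition: no two distinct honest parties output the same party. Theorem. For each of the two kinds of adversary (adaptive and static), there is a protocol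 that achieves $\mathsf{bSM}$ with respect to $t_L$ and $t_R$ in the one-sided network without signatures if and only if both of the following hold: (i) $t_R < k/2$; (ii) $t_L < k/3$ or $t_R < k/3$. -/

import Mathlib

namespace ByzantineSM

/-- The `n = 2k` parties: `Sum.inl i` are the parties of the side `L`, `Sum.inr j` those of the
side `R`. -/
abbrev Party (k : ℕ) : Type := Fin k ⊕ Fin k

/-- `u` and `v` are on opposite sides. -/
def OppositeSides {k : ℕ} (u v : Party k) : Prop := u.isLeft ≠ v.isLeft

theorem OppositeSides.symm {k : ℕ} {u v : Party k} (h : OppositeSides u v) : OppositeSides v u := Ne.symm h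

/-- The parties on the side opposite to `u`, that is, those that `u` can be matched with. -/
abbrev Partner {k : ℕ} (u : Party k) : Type := {v : Party k // OppositeSides u v}

/-- A preference list of `u`: an ordering of the whole opposite side;
`π i` is the party in position `i` (position `0` is the favorite). -/
abbrev PrefList {k : ℕ} (u : Party k) : Type := Fin k ≃ Partner u

/-- A party with preference list `π` strictly prefers `v` to its current match
(`none`: it is alone, which is worse than every party). -/
def Prefers {k : ℕ} {u : Party k} (π : PrefList u) (v : Partner u) : Option (Partner u) → Prop
  | none => True
  | some w => π.symm v < π.symm w

/-- The one-sided network: all pairs of distinct parties are joined by a bidirectional channel,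
except the pairs inside `L`. -/
def oneSidedNetwork (k : ℕ) : SimpleGraph (Party k) where
  Adj u v := u ≠ v ∧ ¬ (u.isLeft = true ∧ v.isLeft = true)
  symm := ⟨fun _ _ h => ⟨h.1.symm, fun h' => h.2 ⟨h'.2, h'.1⟩⟩⟩
  loopless := ⟨fun _ h => h.1 rfl⟩

/-- A (deterministic) synchronous protocol without cryptographic setup. In each round, every party
sends, depending on its local state, a message (or nothing, `none`) on each of its channels, and
then updates its state with the messages received in this round, each labelled by the party at the
other end of the channel. `output u s = none` means that `u` has not yet produced an output in
state `s`; `some none` is the output "nobody" and `some (some v)` is the output `v`. -/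
structure Protocol (k : ℕ) where
  Msg : Type
  State : Type
  init : (u : Party k) → PrefList u → State
  send : Party k → State → Party k → Option Msg
  step : Party k → State → (Party k → Option Msg) → State
  output : (u : Party k) → State → Option (Option (Partner u))

/-- The local state of `u` at the beginning of round `r` when it runs the protocol with input `π`,
where `msg r v u` is the message that it receives from `v` in round `r`. -/
def Protocol.state {k : ℕ} (P : Protocol k) (msg : ℕ → Party k → Party k → Option P.Msg)
    (u : Party k) (π : PrefList u) : ℕ → P.State
  | 0 => P.init u π
  | r + 1 => P.step u (P.state msg u π r) (fun v => msg r v u)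

/-- An execution of the protocol `P` in the network `G`, in the presence of an adversary.
The adversary takes over party `u` at the beginning of round `corruptedAt u`
(`⊤` if `u` is never corrupted). From then on the messages of `u` are arbitrary;
before, they are those prescribed by `P`. -/
structure Execution {k : ℕ} (P : Protocol k) (G : SimpleGraph (Party k)) where
  /-- the preference lists that the parties hold as inputs -/
  input : (u : Party k) → PrefList u
  /-- `msg r u v` is the message sent by `u` and received by `v` in round `r` -/
  msg : ℕ → Party k → Party k → Option P.Msg
  corruptedAt : Party k → ℕ∞
  no_channel : ∀ r u v, ¬ G.Adj u v → msg r u v = none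
  follows : ∀ (r : ℕ) (u v : Party k), (r : ℕ∞) < corruptedAt u → G.Adj u v →
    msg r u v = P.send u (P.state msg u (input u) r) v

/-- A static adversary chooses the corrupted parties at the beginning of the execution, an adaptive
one corrupts parties at any point of the execution. -/
inductive Adversary where
  | static
  | adaptive

namespace Execution

variable {k : ℕ} {P : Protocol k} {G : SimpleGraph (Party k)} (E : Execution P G)

/-- A party is honest if it never became byzantine. -/
def Honest (u : Party k) : Prop := E.corruptedAt u = ⊤

/-- At most `tL` parties of `L` and `tR` parties of `R` are corrupted, by an adversary of the
given kind. -/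
def Admissible (A : Adversary) (tL tR : ℕ) : Prop :=
  {i : Fin k | ¬ E.Honest (Sum.inl i)}.ncard ≤ tL ∧
  {j : Fin k | ¬ E.Honest (Sum.inr j)}.ncard ≤ tR ∧
  (A = Adversary.static → ∀ u, E.corruptedAt u = 0 ∨ E.corruptedAt u = ⊤)

/-- The (final) output of `u` is `o`: the first output that `u` produces. -/
def Outputs (u : Party k) (o : Option (Partner u)) : Prop :=
  ∃ r : ℕ, P.output u (P.state E.msg u (E.input u) r) = some o ∧
    ∀ r' < r, P.output u (P.state E.msg u (E.input u) r') = none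

/-- Every honest party outputs a party on the opposite side or nobody. -/
def Termination : Prop :=
  ∀ u, E.Honest u → ∃ o : Option (Partner u), E.Outputs u o

/-- If honest `u` decides to match honest `v`, then `v` decides to match `u`. -/
def Symmetry : Prop :=
  ∀ (u v : Party k) (h : OppositeSides u v), E.Honest u → E.Honest v →
    E.Outputs u (some ⟨v, h⟩) → E.Outputs v (some ⟨u, h.symm⟩)

/-- No two honest parties on opposite sides prefer each other to their outputs. (The preference is
strict, so `u` does not prefer `v` to its output if this output is already `v`.) -/
def Stability : Prop :=
  ∀ (u v : Party k) (h : OppositeSides u v), E.Honest u → E.Honest v →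
    ∀ (o : Option (Partner u)) (o' : Option (Partner v)), E.Outputs u o → E.Outputs v o' →
      ¬ (Prefers (E.input u) ⟨v, h⟩ o ∧ Prefers (E.input v) ⟨u, h.symm⟩ o')

/-- Two distinct honest parties do not output the same party. -/
def NonCompetition : Prop :=
  ∀ u v : Party k, u ≠ v → E.Honest u → E.Honest v →
    ∀ (x : Partner u) (y : Partner v), E.Outputs u (some x) → E.Outputs v (some y) →
      (x : Party k) ≠ (y : Party k)

end Execution

/-- The protocol `P` achieves byzantine stable matching in the network `G` with respect to `tL` and
`tR`, against adversaries of the given kind. -/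
def Protocol.AchievesBSM {k : ℕ} (P : Protocol k) (G : SimpleGraph (Party k)) (A : Adversary)
    (tL tR : ℕ) : Prop :=
  ∀ E : Execution P G, E.Admissible A tL tR →
    E.Termination ∧ E.Symmetry ∧ E.Stability ∧ E.NonCompetition

/-- Byzantine stable matching is solvable in the unauthenticated synchronous network `G`. -/
def BSMSolvable {k : ℕ} (G : SimpleGraph (Party k)) (A : Adversary) (tL tR : ℕ) : Prop :=
  ∃ P : Protocol k, P.AchievesBSM G A tL tR

end ByzantineSM

namespace ByzantineSM

/-! Impossibility is a covering argument. Run two copies of the network with the edges between two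
groups of parties, `0` and `2`, crossed. For suitable byzantine sets, each of three executions
embeds in this double cover, the byzantine parties simulating whatever lies outside. In the first
execution an honest `a` and `x` are mutual favorites, which forces `a` to output `x`; in the second
the same holds for `a'` and `x`. In the third, `a` and `a'` are both honest and cannot tell that
they are not in the first and second execution, so both output `x`, against non-competition
(`not_solvable_of_groups`). If `k ≤ 2 * tR`, the missing channels inside `L` let half of `R`
separate two parties of `L`; if `k ≤ 3 * tL` and `k ≤ 3 * tR`, the groups are residue classes mod 3.

For the converse, an honest majority of `R` relays every message, so that honest broadcasts arrive
intact everywhere, as in a complete network (`receivedAt_eq`); byzantine senders may still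
equivocate. One side, the core, has fewer than a third of its parties corrupted. It runs the phase
king algorithm on each party's input, with all other parties listening, so the honest parties agree
on one profile containing the true inputs of the honest ones (`exists_agreed_profile`). Everyone
then takes its partner in the same stable matching of this profile. -/

/-! ### Preference lists and mutual favorites. -/

theorem oppositeSides_inl_inr {k : ℕ} (i j : Fin k) :
    OppositeSides (Sum.inl i : Party k) (Sum.inr j) := by simp [OppositeSides]

/-- The parties of `R`, as the partners of a party of `L`. -/
def rightPartner {k : ℕ} (i : Fin k) : Fin k ≃ Partner (Sum.inl i : Party k) where
  toFun j := ⟨Sum.inr j, oppositeSides_inl_inr i j⟩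
  invFun v := Sum.elim id id v.1
  left_inv _ := rfl
  right_inv := by
    rintro ⟨j | j, h⟩
    · simp [OppositeSides] at h
    · rfl

/-- The parties of `L`, as the partners of a party of `R`. -/
def leftPartner {k : ℕ} (j : Fin k) : Fin k ≃ Partner (Sum.inr j : Party k) where
  toFun i := ⟨Sum.inl i, (oppositeSides_inl_inr i j).symm⟩
  invFun v := Sum.elim id id v.1
  left_inv _ := rfl
  right_inv := by
    rintro ⟨i | i, h⟩
    · rfl
    · simp [OppositeSides] at h

/-- A preference list for every party. -/
def defaultPref {k : ℕ} : (u : Party k) → PrefList u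
  | Sum.inl i => rightPartner i
  | Sum.inr j => leftPartner j

theorem exists_prefList_favorite {k : ℕ} (hk : 0 < k) {u : Party k} (v : Partner u) :
    ∃ π : PrefList u, π.symm v = ⟨0, hk⟩ :=
  ⟨(Equiv.swap ⟨0, hk⟩ ((defaultPref u).symm v)).trans (defaultPref u), by simp⟩

theorem Prefers.of_favorite {k : ℕ} {hk : 0 < k} {u : Party k} {π : PrefList u} {v : Partner u}
    (hv : π.symm v = ⟨0, hk⟩) {o : Option (Partner u)} (ho : o ≠ some v) : Prefers π v o := by
  rcases o with _ | w
  · trivial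
  · have hw : π.symm w ≠ π.symm v := fun h => ho (by rw [π.symm.injective h])
    change π.symm v < π.symm w
    rw [hv] at hw ⊢
    exact lt_of_le_of_ne (Fin.mk_le_of_le_val (Nat.zero_le _)) hw.symm

/-- Two honest parties that are each other's favorites are matched. -/
theorem Execution.outputs_of_favorites {k : ℕ} (hk : 0 < k) {P : Protocol k}
    {G : SimpleGraph (Party k)} {E : Execution P G} (hT : E.Termination) (hSym : E.Symmetry)
    (hSt : E.Stability) {u v : Party k} (h : OppositeSides u v) (hu : E.Honest u)
    (hv : E.Honest v) (huv : (E.input u).symm ⟨v, h⟩ = ⟨0, hk⟩)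
    (hvu : (E.input v).symm ⟨u, h.symm⟩ = ⟨0, hk⟩) : E.Outputs u (some ⟨v, h⟩) := by
  obtain ⟨o, ho⟩ := hT u hu
  obtain ⟨o', ho'⟩ := hT v hv
  by_cases h1 : o = some ⟨v, h⟩
  · exact h1 ▸ ho
  by_cases h2 : o' = some ⟨u, h.symm⟩
  · exact hSym v u h.symm hv hu (h2 ▸ ho')
  · exact absurd ⟨Prefers.of_favorite huv h1, Prefers.of_favorite hvu h2⟩
      (hSt u v h hu hv o o' ho ho')

/-! ### Covers of the network and indistinguishable executions. -/

section Cover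

variable {k : ℕ} (P : Protocol k) (G : SimpleGraph (Party k)) {I : Type}
  (input : I → (u : Party k) → PrefList u) (nb : Party k → Party k → I → I)

open Classical in
/-- Run a copy of `u` for every `b : I`, where the copy `b` of `u` receives its messages from the
copy `nb u v b` of each neighbor `v`. -/
noncomputable def coverState : ℕ → Party k → I → P.State
  | 0, u, b => P.init u (input b u)
  | r + 1, u, b => P.step u (coverState r u b)
      (fun v => if G.Adj v u then P.send v (coverState r v (nb u v b)) u else none)

/-- There is an execution in which the parties outside `B` run their copies chosen by `s`, while
the byzantine parties in `B` simulate the remaining copies. -/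
theorem exists_cover_execution (s : Party k → I) (B : Set (Party k))
    (hs : ∀ u v, G.Adj u v → u ∉ B → v ∉ B → nb v u (s v) = s u) :
    ∃ E : Execution P G, (∀ u, E.input u = input (s u) u) ∧
      (∀ u, E.corruptedAt u = 0 ∨ E.corruptedAt u = ⊤) ∧ (∀ u, E.Honest u ↔ u ∉ B) ∧
      ∀ r, ∀ u ∉ B, P.state E.msg u (E.input u) r = coverState P G input nb r u (s u) := by
  classical
  -- Towards `v`, a byzantine `u` plays the copy of `u` that the copy `s v` of `v` listens to; it
  -- may thus play different copies towards different neighbors.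
  let msg : ℕ → Party k → Party k → Option P.Msg := fun r u v => if G.Adj u v then
    P.send u (coverState P G input nb r u (if u ∈ B then nb v u (s v) else s u)) v else none
  have hstate : ∀ r, ∀ u ∉ B,
      P.state msg u (input (s u) u) r = coverState P G input nb r u (s u) := by
    intro r
    induction r with
    | zero => intro u _; rfl
    | succ r ih =>
      intro u hu
      rw [Protocol.state, coverState, ih u hu]
      congr 1
      funext v
      by_cases hvu : G.Adj v u
      · by_cases hv : v ∈ B
        · simp [msg, hvu, hv]
        · simp [msg, hvu, hv, hs v u hvu hv hu]
      · simp [msg, hvu]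
  refine ⟨⟨fun u => input (s u) u, msg, fun u => if u ∈ B then 0 else ⊤, ?_, ?_⟩, fun _ => rfl,
    ?_, ?_, hstate⟩
  · intro r u v h
    simp [msg, h]
  · intro r u v hr h
    by_cases hu : u ∈ B
    · simp [hu] at hr
    · simp [msg, h, hu, hstate r u hu]
  · intro u
    by_cases hu : u ∈ B <;> simp [hu]
  · intro u
    by_cases hu : u ∈ B <;> simp [Execution.Honest, hu]

end Cover

/-- The copy of `v` next to the copy `b` of `u` in the double cover that is crossed between
the groups `0` and `2`. -/
def crossedSheet {k : ℕ} (g : Party k → ℕ) (u v : Party k) (b : Bool) : Bool :=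
  if (g u = 0 ∧ g v = 2) ∨ (g u = 2 ∧ g v = 0) then !b else b

/-- If each of the sets `B₀`, `B₁`, `B₂` may be corrupted, and they suffice to hide the crossing
between the groups `0` and `2`, then byzantine stable matching is impossible. -/
theorem not_solvable_of_groups {k tL tR : ℕ} {A : Adversary} (hk : 0 < k)
    (G : SimpleGraph (Party k)) (g : Party k → ℕ)
    (B₀ B₁ B₂ : Set (Party k)) (a a' x : Party k) (hax : OppositeSides a x)
    (hax' : OppositeSides a' x) (ha : g a = 0) (ha' : g a' = 2)
    (hB : ∀ B ∈ ({B₀, B₁, B₂} : Set (Set (Party k))),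
      {i : Fin k | Sum.inl i ∈ B}.ncard ≤ tL ∧ {j : Fin k | Sum.inr j ∈ B}.ncard ≤ tR)
    (h₀ : ∀ u v, G.Adj u v → g u = 0 → g v = 2 → u ∈ B₀ ∨ v ∈ B₀)
    (h₂ : ∀ u v, G.Adj u v → g u = 0 → g v = 2 → u ∈ B₂ ∨ v ∈ B₂)
    (h₁ : ∀ u, g u ≠ 0 → g u ≠ 2 → u ∈ B₁)
    (ha₂ : a ∉ B₂) (hx₂ : x ∉ B₂) (ha₀ : a' ∉ B₀) (hx₀ : x ∉ B₀) (ha₁ : a ∉ B₁) (ha₁' : a' ∉ B₁) :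
    ¬ BSMSolvable G A tL tR := by
  classical
  rintro ⟨P, hP⟩
  have hne : a ≠ a' := by rintro rfl; omega
  obtain ⟨πa, hπa⟩ := exists_prefList_favorite hk (⟨x, hax⟩ : Partner a)
  obtain ⟨πa', hπa'⟩ := exists_prefList_favorite hk (⟨x, hax'⟩ : Partner a')
  obtain ⟨πx, hπx⟩ := exists_prefList_favorite hk (⟨a, hax.symm⟩ : Partner x)
  obtain ⟨πx', hπx'⟩ := exists_prefList_favorite hk (⟨a', hax'.symm⟩ : Partner x)
  have hxa : x ≠ a := by rintro rfl; exact hax rfl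
  have hxa' : x ≠ a' := by rintro rfl; exact hax' rfl
  let base : (u : Party k) → PrefList u := Function.update (Function.update defaultPref a πa) a' πa'
  -- The sheets differ only in the favorite of `x`: it is `a` on sheet `false` and `a'` on sheet
  -- `true`.
  let input : Bool → (u : Party k) → PrefList u := fun b =>
    Function.update base x (if b then πx' else πx)
  have hia : ∀ b, input b a = πa := fun b => by
    simp [input, base, Function.update_of_ne hxa.symm, Function.update_of_ne hne]
  have hia' : ∀ b, input b a' = πa' := fun b => by
    simp [input, base, Function.update_of_ne hxa'.symm]
  have hix : input false x = πx := by simp [input]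
  have hix' : input true x = πx' := by simp [input]
  have adm : ∀ B ∈ ({B₀, B₁, B₂} : Set (Set (Party k))), ∀ E : Execution P G,
      (∀ u, E.corruptedAt u = 0 ∨ E.corruptedAt u = ⊤) → (∀ u, E.Honest u ↔ u ∉ B) →
      E.Termination ∧ E.Symmetry ∧ E.Stability ∧ E.NonCompetition := by
    intro B hBm E hc hh
    refine hP E ⟨?_, ?_, fun _ => hc⟩
    · simpa [hh] using (hB B hBm).1
    · simpa [hh] using (hB B hBm).2
  have const : ∀ (b : Bool) (B : Set (Party k)),
      (∀ u v, G.Adj u v → g u = 0 → g v = 2 → u ∈ B ∨ v ∈ B) →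
      ∀ u v, G.Adj u v → u ∉ B → v ∉ B → crossedSheet g v u b = b := by
    intro b B h u v huv hu hv
    unfold crossedSheet
    rw [if_neg]
    rintro (⟨h1, h2⟩ | ⟨h1, h2⟩)
    · exact (h v u huv.symm h1 h2).elim hv hu
    · exact (h u v huv h2 h1).elim hu hv
  -- `E` and `E'` each live on a single sheet, and `B₂`, `B₀` hide the crossing. In `F` the honest
  -- parties are in group `0` on sheet `false` or in group `2` on sheet `true`, so their channels
  -- agree with the crossing.
  obtain ⟨E, hin, hc, hh, hst⟩ := exists_cover_execution P G input (crossedSheet g)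
    (fun _ => false) B₂ (const false B₂ h₂)
  obtain ⟨E', hin', hc', hh', hst'⟩ := exists_cover_execution P G input (crossedSheet g)
    (fun _ => true) B₀ (const true B₀ h₀)
  obtain ⟨F, hinF, hcF, hhF, hstF⟩ := exists_cover_execution P G input (crossedSheet g)
    (fun u => decide (g u = 2)) B₁ (by
      intro u v _ hu hv
      have hu' : g u = 0 ∨ g u = 2 := by
        by_contra h; push Not at h; exact hu (h₁ u h.1 h.2)
      have hv' : g v = 0 ∨ g v = 2 := by
        by_contra h; push Not at h; exact hv (h₁ v h.1 h.2)
      rcases hu' with hu' | hu' <;> rcases hv' with hv' | hv' <;>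
        simp [crossedSheet, hu', hv'])
  obtain ⟨T, Sy, St, -⟩ := adm B₂ (by simp) E hc hh
  obtain ⟨T', Sy', St', -⟩ := adm B₀ (by simp) E' hc' hh'
  obtain ⟨-, -, -, NC⟩ := adm B₁ (by simp) F hcF hhF
  have out : E.Outputs a (some ⟨x, hax⟩) :=
    E.outputs_of_favorites hk T Sy St hax ((hh a).2 ha₂) ((hh x).2 hx₂)
      (by rw [hin, hia, hπa]) (by rw [hin, hix, hπx])
  have out' : E'.Outputs a' (some ⟨x, hax'⟩) :=
    E'.outputs_of_favorites hk T' Sy' St' hax' ((hh' a').2 ha₀) ((hh' x).2 hx₀)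
      (by rw [hin', hia', hπa']) (by rw [hin', hix', hπx'])
  refine NC a a' hne ((hhF a).2 ha₁) ((hhF a').2 ha₁') ⟨x, hax⟩ ⟨x, hax'⟩ ?_ ?_ rfl
  · simp only [Execution.Outputs, hst _ a ha₂] at out
    simpa only [Execution.Outputs, hstF _ a ha₁, ha, show decide ((0 : ℕ) = 2) = false from rfl] using out
  · simp only [Execution.Outputs, hst' _ a' ha₀] at out'
    simpa only [Execution.Outputs, hstF _ a' ha₁', ha', decide_true] using out'

/-! ### The two regimes of impossibility. -/

theorem ncard_fin_le_of_injOn {k t : ℕ} (S : Set (Fin k)) (f : Fin k → ℕ)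
    (hf : ∀ i ∈ S, f i < t) (hinj : Set.InjOn f S) : S.ncard ≤ t := by
  have h := Set.ncard_le_ncard_of_injOn (s := S) (t := ↑(Finset.range t)) f
    (fun i hi => by simpa using hf i hi) hinj (Finset.finite_toSet _)
  rwa [Set.ncard_coe_finset, Finset.card_range] at h

/-- `R` splits into halves `C` and `D`, each of which may be corrupted. Group `0` is one party of
`L`, group `2` is the rest of `L` with `C`. Since `L` has no inner channels, all crossed channels
end in `C`, so `C` serves as both `B₀` and `B₂`, and `D`, which contains `x`, as `B₁`. -/
theorem not_solvable_of_le_two_mul {k tL tR : ℕ} {A : Adversary} (hk : 2 ≤ k)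
    (h : k ≤ 2 * tR) : ¬ BSMSolvable (oneSidedNetwork k) A tL tR := by
  let C : Set (Party k) := {u | ∃ j : Fin k, u = Sum.inr j ∧ (j : ℕ) < k / 2}
  let D : Set (Party k) := {u | ∃ j : Fin k, u = Sum.inr j ∧ k / 2 ≤ (j : ℕ)}
  have hC : {i : Fin k | Sum.inl i ∈ C}.ncard ≤ tL ∧ {j : Fin k | Sum.inr j ∈ C}.ncard ≤ tR := by
    refine ⟨by simp [C], ncard_fin_le_of_injOn _ (fun j => j) ?_ (fun i _ j _ hij => Fin.ext hij)⟩
    intro i hi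
    have : (i : ℕ) < k / 2 := by simpa [C] using hi
    omega
  have hD : {i : Fin k | Sum.inl i ∈ D}.ncard ≤ tL ∧ {j : Fin k | Sum.inr j ∈ D}.ncard ≤ tR := by
    refine ⟨by simp [D], ncard_fin_le_of_injOn _ (fun j => j - k / 2) ?_ ?_⟩
    · intro i hi
      have : k / 2 ≤ (i : ℕ) := by simpa [D] using hi
      have := i.2
      omega
    · intro i hi j hj hij
      have h1 : k / 2 ≤ (i : ℕ) := by simpa [D] using hi
      have h2 : k / 2 ≤ (j : ℕ) := by simpa [D] using hj
      simp only at hij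
      exact Fin.ext (by omega)
  let g : Party k → ℕ := fun u => match u with
    | Sum.inl i => if (i : ℕ) = 0 then 0 else 2
    | Sum.inr j => if (j : ℕ) < k / 2 then 2 else 1
  have hcross : ∀ u v, (oneSidedNetwork k).Adj u v → g u = 0 → g v = 2 → u ∈ C ∨ v ∈ C := by
    rintro (i | i) (j | j) ⟨_, hadj⟩ hu hv
    · simp at hadj
    · right
      by_cases hj : (j : ℕ) < k / 2
      · simpa [C] using hj
      · simp [g, hj] at hv
    all_goals
      by_cases hi : (i : ℕ) < k / 2 <;> simp [g, hi] at hu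
  refine not_solvable_of_groups (by omega) _ g C D C (Sum.inl ⟨0, by omega⟩)
    (Sum.inl ⟨1, by omega⟩) (Sum.inr ⟨k - 1, by omega⟩) (by simp [OppositeSides])
    (by simp [OppositeSides]) (by simp [g]) (by simp [g]) ?_ hcross hcross ?_ ?_ ?_ ?_ ?_ ?_ ?_
  · rintro B (rfl | rfl | rfl)
    exacts [hC, hD, hC]
  · rintro (i | i) h1 h2
    · by_cases hi : (i : ℕ) = 0 <;> simp [g, hi] at h1 h2
    · by_cases hi : (i : ℕ) < k / 2
      · simp [g, hi] at h2
      · simpa [D] using hi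
  all_goals simp [C, D]
  all_goals omega

/-- Each residue class mod 3 holds at most `tL` parties of `L` and `tR` of `R`, so any one class may
be corrupted; the channels missing inside `L` play no role. -/
theorem not_solvable_of_le_three_mul {k tL tR : ℕ} {A : Adversary} (hk : 3 ≤ k)
    (hL : k ≤ 3 * tL) (hR : k ≤ 3 * tR) : ¬ BSMSolvable (oneSidedNetwork k) A tL tR := by
  let g : Party k → ℕ := fun u => match u with
    | Sum.inl i => (i : ℕ) % 3
    | Sum.inr j => (j : ℕ) % 3
  have hcard : ∀ c t : ℕ, k ≤ 3 * t → {i : Fin k | (i : ℕ) % 3 = c}.ncard ≤ t := by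
    intro c t ht
    refine ncard_fin_le_of_injOn _ (fun i => i / 3) (fun i _ => ?_) ?_
    · have := i.2
      omega
    · intro i hi j hj hij
      simp only [Set.mem_ofPred_eq] at hi hj hij
      exact Fin.ext (by omega)
  refine not_solvable_of_groups (by omega) _ g {u | g u = 0} {u | g u = 1} {u | g u = 2}
    (Sum.inl ⟨0, by omega⟩) (Sum.inl ⟨2, by omega⟩) (Sum.inr ⟨1, by omega⟩)
    (by simp [OppositeSides]) (by simp [OppositeSides]) (by simp [g]) (by simp [g]) ?_
    (fun u v _ hu _ => Or.inl hu) (fun u v _ _ hv => Or.inr hv) ?_ ?_ ?_ ?_ ?_ ?_ ?_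
  · rintro B (rfl | rfl | rfl)
    exacts [⟨hcard 0 tL hL, hcard 0 tR hR⟩, ⟨hcard 1 tL hL, hcard 1 tR hR⟩,
      ⟨hcard 2 tL hL, hcard 2 tR hR⟩]
  · intro u h1 h2
    have : g u < 3 := by
      rcases u with i | i <;> exact Nat.mod_lt _ (by norm_num)
    simp only [Set.mem_ofPred_eq]
    omega
  all_goals simp [g]

/-! ### Existence of stable matchings. -/

/-- Existence of a stable matching. `p i` is the position of the current proposal of `i` in the
deferred acceptance algorithm; a maximal consistent state of the algorithm is a matching. -/
theorem exists_stable_matching {k : ℕ} (f : Fin k → (Fin k ≃ Fin k)) (g : Fin k → (Fin k ≃ Fin k)) :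
    ∃ m : Fin k ≃ Fin k, ∀ i j,
      ¬ ((f i).symm j < (f i).symm (m i) ∧ (g j).symm i < (g j).symm (m.symm j)) := by
  classical
  -- Consistency: whoever `i` has already passed over currently has a proposal that it prefers to
  -- `i`.
  let S : Set (Fin k → Fin k) := {p | ∀ i, ∀ q < p i, ∃ i', f i' (p i') = f i q ∧
    (g (f i q)).symm i' < (g (f i q)).symm i}
  have hS : Nonempty S := by
    rcases Nat.eq_zero_or_pos k with rfl | hk
    · exact ⟨⟨fun i => i.elim0, fun i => i.elim0⟩⟩
    · refine ⟨⟨fun _ => ⟨0, hk⟩, fun i q hq => absurd hq ?_⟩⟩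
      simp [Fin.lt_def]
  obtain ⟨⟨p, hp⟩, hmax⟩ := Finite.exists_max (fun p : S => ∑ i, ((p : Fin k → Fin k) i : ℕ))
  have step : ∀ i i', i ≠ i' → f i (p i) = f i' (p i') →
      ¬ (g (f i (p i))).symm i' < (g (f i (p i))).symm i := by
    intro i i' hne heq hlt
    -- A rejection at the end of the list would mean that every party has a proposal; a surjective
    -- proposal map is injective, contradicting the collision of `i` and `i'`.
    have hbound : (p i : ℕ) + 1 < k := by
      by_contra hcon
      have hsurj : Function.Surjective (fun n => f n (p n)) := by
        intro w
        by_cases hw : w = f i (p i)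
        · exact ⟨i, hw.symm⟩
        · have hq : (f i).symm w ≠ p i := fun h => hw (by rw [← h]; simp)
          have hq' : (f i).symm w < p i := by
            have := ((f i).symm w).2
            have := Fin.val_ne_of_ne hq
            rw [Fin.lt_def]
            omega
          obtain ⟨n, hn, -⟩ := hp i _ hq'
          exact ⟨n, by simpa using hn⟩
      exact hne (Finite.injective_iff_surjective.2 hsurj heq)
    have hmem : Function.update p i ⟨p i + 1, hbound⟩ ∈ S := by
      -- Advancing `i` never worsens the best proposal anyone holds: the party that `i` leaves keeps
      -- `i'`, which it prefers.
      have key : ∀ n w, f n (p n) = w → ∃ n', f n' (Function.update p i ⟨p i + 1, hbound⟩ n') = w ∧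
          (g w).symm n' ≤ (g w).symm n := by
        rintro n w rfl
        by_cases hn : n = i
        · subst hn
          exact ⟨i', by rw [Function.update_of_ne hne.symm, heq], hlt.le⟩
        · exact ⟨n, by rw [Function.update_of_ne hn], le_rfl⟩
      intro n q hq
      have hold : q < p n ∨ n = i ∧ q = p i := by
        by_cases hn : n = i
        · subst hn
          simp only [Function.update_self, Fin.lt_def] at hq
          rcases Nat.lt_succ_iff_lt_or_eq.1 hq with h | h
          · exact Or.inl h
          · exact Or.inr ⟨rfl, Fin.ext h⟩
        · rw [Function.update_of_ne hn] at hq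
          exact Or.inl hq
      rcases hold with hq | ⟨rfl, rfl⟩
      · obtain ⟨n₁, h1, h2⟩ := hp n q hq
        obtain ⟨n₂, h3, h4⟩ := key n₁ _ h1
        exact ⟨n₂, h3, h4.trans_lt h2⟩
      · obtain ⟨n₂, h3, h4⟩ := key i' _ heq.symm
        exact ⟨n₂, h3, h4.trans_lt hlt⟩
    have hle := hmax ⟨_, hmem⟩
    refine absurd hle (not_le.2 (Finset.sum_lt_sum (fun n _ => ?_) ⟨i, Finset.mem_univ _, ?_⟩))
    · by_cases hn : n = i
      · subst hn; simp
      · simp [Function.update_of_ne hn]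
    · simp
  have hinj : Function.Injective (fun i => f i (p i)) := by
    intro i i' heq
    by_contra hne
    rcases lt_trichotomy ((g (f i (p i))).symm i') ((g (f i (p i))).symm i) with h | h | h
    · exact step i i' hne heq h
    · exact hne ((g _).symm.injective h).symm
    · refine step i' i (Ne.symm hne) heq.symm ?_
      rwa [← show f i (p i) = f i' (p i') from heq]
  refine ⟨Equiv.ofBijective _ (Finite.injective_iff_bijective.1 hinj), ?_⟩
  rintro i j ⟨h1, h2⟩
  rw [Equiv.ofBijective_apply, Equiv.symm_apply_apply] at h1
  obtain ⟨i', h3, h4⟩ := hp i _ h1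
  rw [Equiv.apply_symm_apply] at h3 h4
  have h5 : (Equiv.ofBijective _ (Finite.injective_iff_bijective.1 hinj)).symm j = i' :=
    (Equiv.symm_apply_eq _).2 (by simpa using h3.symm)
  rw [h5] at h2
  exact lt_asymm h2 h4

/-! ### The phase king algorithm. -/

/-- `some z` for a value `z` that occurs at least `n` times in `f` (`none` if there is none). -/
noncomputable def frequentValue {k : ℕ} {V : Type} (n : ℕ) (f : Fin k → Option V) : Option V :=
  open Classical in
  if h : ∃ z : V, n ≤ {i | f i = some z}.ncard then some h.choose else none

theorem le_ncard_of_frequentValue {k n : ℕ} {V : Type} {f : Fin k → Option V} {z : V}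
    (h : frequentValue n f = some z) : n ≤ {i | f i = some z}.ncard := by
  unfold frequentValue at h
  split_ifs at h with hz
  obtain rfl := Option.some_injective _ h
  exact hz.choose_spec

/-- The state of a party in the phase king algorithm: its current value, and whether it keeps this
value irrespective of the king. -/
abbrev KingState (V : Type) : Type := Option V × Bool

/-- One broadcast round of the phase king algorithm on `k` parties of which `t` may be byzantine;
`m` is the message of the king, `f` are the messages of all parties. -/
noncomputable def kingStep {V : Type} (k t : ℕ) (d : V) (r : ℕ) (s : KingState V) (m : Option V)
    (f : Fin k → Option V) : KingState V :=
  open Classical in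
  if r % 3 = 1 then (frequentValue (k - t) f, false)
  else if r % 3 = 2 then
    (frequentValue (t + 1) f, decide (∃ z : V, k - t ≤ {i | f i = some z}.ncard))
  -- Round `0` is of this kind too: a king round before all phases, in which the source distributes
  -- its value.
  else (if s.2 then s.1 else some (m.getD d), false)

/-- An execution of the phase king algorithm among the parties `ι` (most of them listeners), as
seen by the parties in `H`, when the broadcasts of the core parties `c i` are received. -/
structure KingRun {ι V : Type} (k t : ℕ) (d : V) (H : Set ι) (c : Fin k → ι) (king : ℕ → ι) where
  state : ℕ → ι → KingState V
  received : ℕ → ι → ι → Option V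
  update : ∀ r, ∀ u ∈ H, state (r + 1) u =
    kingStep k t d r (state r u) (received r u (king r)) (fun i => received r u (c i))
  reliable : ∀ r, ∀ u ∈ H, ∀ v ∈ H, received r u v = (state r v).1
  few_faults : {i | c i ∉ H}.ncard ≤ t
  resilience : 3 * t < k

namespace KingRun

variable {ι V : Type} {k t : ℕ} {d : V} {H : Set ι} {c : Fin k → ι} {king : ℕ → ι}
  (K : KingRun k t d H c king)

include K in
theorem exists_honest_of_lt_ncard {S : Set (Fin k)} (h : t < S.ncard) : ∃ i ∈ S, c i ∈ H := by
  by_contra! hcon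
  have := Set.ncard_le_ncard (s := S) (t := {i | c i ∉ H}) hcon
  have := K.few_faults
  omega

include K in
-- Two sets of `k - t` core parties share at least `k - 2 * t > t` of them, hence an honest one,
-- which reports the same value to both observers.
theorem eq_of_frequent {r : ℕ} {u v : ι} (hu : u ∈ H) (hv : v ∈ H) {z z' : V}
    (hz : k - t ≤ {i | K.received r u (c i) = some z}.ncard)
    (hz' : k - t ≤ {i | K.received r v (c i) = some z'}.ncard) : z = z' := by
  have hunion := Set.ncard_union_add_ncard_inter {i | K.received r u (c i) = some z}
    {i | K.received r v (c i) = some z'}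
  have hle := Set.ncard_le_card
    ({i | K.received r u (c i) = some z} ∪ {i | K.received r v (c i) = some z'})
  rw [Nat.card_eq_fintype_card, Fintype.card_fin] at hle
  have := K.resilience
  obtain ⟨i, ⟨h1, h2⟩, hi⟩ := K.exists_honest_of_lt_ncard (S := {i | K.received r u (c i) = some z} ∩
    {i | K.received r v (c i) = some z'}) (by omega)
  have h1' : K.received r u (c i) = some z := h1
  have h2' : K.received r v (c i) = some z' := h2
  rw [K.reliable r _ hu _ hi] at h1'
  rw [K.reliable r _ hv _ hi] at h2'
  exact Option.some_injective _ (h1'.symm.trans h2')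

include K in
theorem exists_honest_holder {r : ℕ} {u : ι} (hu : u ∈ H) {z : V}
    (hz : t + 1 ≤ {i | K.received r u (c i) = some z}.ncard) :
    ∃ i, c i ∈ H ∧ (K.state r (c i)).1 = some z := by
  obtain ⟨i, h1, hi⟩ := K.exists_honest_of_lt_ncard hz
  exact ⟨i, hi, (K.reliable r _ hu _ hi).symm.trans h1⟩

/-- All parties in `H` have the value `v`. -/
def AllHold (r : ℕ) (v : V) : Prop := ∀ u ∈ H, (K.state r u).1 = some v

theorem AllHold.frequent {K : KingRun k t d H c king} {r : ℕ} {v : V} (h : K.AllHold r v) {u : ι}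
    (hu : u ∈ H) : k - t ≤ {i | K.received r u (c i) = some v}.ncard := by
  have hsub : {i | c i ∉ H}ᶜ ⊆ {i | K.received r u (c i) = some v} := by
    intro i hi
    have hi' : c i ∈ H := by simpa using hi
    exact (K.reliable r u hu _ hi').trans (h _ hi')
  have h1 := Set.ncard_le_ncard hsub
  have h2 := Set.ncard_add_ncard_compl {i | c i ∉ H}
  rw [Nat.card_eq_fintype_card, Fintype.card_fin] at h2
  have := K.few_faults
  omega

/-- Parties in `H` that hold a value at all hold the same one. -/
def Unanimous (r : ℕ) : Prop :=
  ∀ u ∈ H, ∀ v ∈ H, ∀ z z', (K.state r u).1 = some z → (K.state r v).1 = some z' → z = z'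

theorem state_exchange {r : ℕ} (hr : r % 3 = 1) {u : ι} (hu : u ∈ H) :
    K.state (r + 1) u = (frequentValue (k - t) (fun i => K.received r u (c i)), false) := by
  rw [K.update r u hu, kingStep, if_pos hr]

open Classical in
theorem state_proposal {r : ℕ} (hr : r % 3 = 2) {u : ι} (hu : u ∈ H) :
    K.state (r + 1) u = (frequentValue (t + 1) (fun i => K.received r u (c i)),
      decide (∃ z : V, k - t ≤ {i | K.received r u (c i) = some z}.ncard)) := by
  rw [K.update r u hu, kingStep, if_neg (by omega), if_pos hr]

theorem state_king {r : ℕ} (hr : r % 3 = 0) {u : ι} (hu : u ∈ H) :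
    K.state (r + 1) u = (if (K.state r u).2 then (K.state r u).1
      else some ((K.received r u (king r)).getD d), false) := by
  rw [K.update r u hu, kingStep, if_neg (by omega), if_neg (by omega)]

theorem unanimous_exchange {r : ℕ} (hr : r % 3 = 1) : K.Unanimous (r + 1) := by
  intro u hu v hv z z' hz hz'
  rw [K.state_exchange hr hu] at hz
  rw [K.state_exchange hr hv] at hz'
  exact K.eq_of_frequent hu hv (le_ncard_of_frequentValue hz) (le_ncard_of_frequentValue hz')

/-- Of the `k - t` reports, at least `k - 2 * t ≥ t + 1` are honest and reach `v` as well. Any value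
seen `t + 1` times has an honest holder, so unanimity leaves `z` as the only candidate. -/
theorem frequentValue_proposal {r : ℕ} (h : K.Unanimous r) {u v : ι} (hu : u ∈ H) (hv : v ∈ H)
    {z : V} (hz : k - t ≤ {i | K.received r u (c i) = some z}.ncard) :
    frequentValue (t + 1) (fun i => K.received r v (c i)) = some z := by
  have hz' : t + 1 ≤ {i | K.received r v (c i) = some z}.ncard := by
    have hsub : {i | K.received r u (c i) = some z} \ {i | c i ∉ H} ⊆
        {i | K.received r v (c i) = some z} := by
      rintro i ⟨h1, h2⟩
      have hi : c i ∈ H := by simpa using h2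
      have h1' : K.received r u (c i) = some z := h1
      rw [K.reliable r _ hu _ hi] at h1'
      exact (K.reliable r v hv _ hi).trans h1'
    have h1 := Set.ncard_le_ncard hsub
    have h2 := Set.le_ncard_sdiff {i | c i ∉ H} {i | K.received r u (c i) = some z}
    have := K.few_faults
    have := K.resilience
    omega
  obtain ⟨y, hy⟩ : ∃ y, frequentValue (t + 1) (fun i => K.received r v (c i)) = some y := by
    unfold frequentValue
    rw [dif_pos ⟨z, hz'⟩]
    exact ⟨_, rfl⟩
  obtain ⟨i, hi, hiy⟩ := K.exists_honest_holder hv (le_ncard_of_frequentValue hy)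
  obtain ⟨j, hj, hjz⟩ := K.exists_honest_holder hv hz'
  rw [hy, h _ hi _ hj _ _ hiy hjz]

/-- Persistence: a common value makes every honest party set its flag, so even a byzantine king is
ignored. -/
theorem AllHold.phase {K : KingRun k t d H c king} {r : ℕ} (hr : r % 3 = 1) {v : V}
    (h : K.AllHold r v) : K.AllHold (r + 3) v := by
  have h1 : K.AllHold (r + 1) v := by
    intro u hu
    rw [K.state_exchange hr hu]
    obtain ⟨y, hy⟩ : ∃ y, frequentValue (k - t) (fun i => K.received r u (c i)) = some y := by
      unfold frequentValue
      rw [dif_pos ⟨v, h.frequent hu⟩]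
      exact ⟨_, rfl⟩
    rw [hy, K.eq_of_frequent hu hu (le_ncard_of_frequentValue hy) (h.frequent hu)]
  intro u hu
  rw [K.state_king (r := r + 2) (by omega) hu, K.state_proposal (r := r + 1) (by omega) hu]
  have h2 : ∃ z : V, k - t ≤ {i | K.received (r + 1) u (c i) = some z}.ncard :=
    ⟨v, h1.frequent hu⟩
  dsimp only
  rw [if_pos (by simpa only [decide_eq_true_eq] using h2)]
  exact K.frequentValue_proposal (K.unanimous_exchange hr) hu hu (h1.frequent hu)

/-- Either some honest party saw `k - t` equal proposals, and then all of them, the king included,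
already hold that value; or no flag is set and all adopt the word of the honest king. -/
theorem exists_allHold_of_king {r : ℕ} (hr : r % 3 = 1) (hking : king (r + 2) ∈ H) :
    ∃ v, K.AllHold (r + 3) v := by
  classical
  by_cases hstrong : ∃ u ∈ H, ∃ z, k - t ≤ {i | K.received (r + 1) u (c i) = some z}.ncard
  · obtain ⟨u, hu, z, hz⟩ := hstrong
    have hall : K.AllHold (r + 2) z := fun v hv => by
      rw [K.state_proposal (r := r + 1) (by omega) hv]
      exact K.frequentValue_proposal (K.unanimous_exchange hr) hu hv hz
    refine ⟨z, fun v hv => ?_⟩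
    rw [K.state_king (r := r + 2) (by omega) hv, K.reliable _ _ hv _ hking, hall _ hking,
      hall v hv]
    simp
  · push Not at hstrong
    refine ⟨((K.state (r + 2) (king (r + 2))).1).getD d, fun v hv => ?_⟩
    have h2 : (K.state (r + 2) v).2 = false := by
      rw [K.state_proposal (r := r + 1) (by omega) hv]
      exact decide_eq_false fun ⟨z, hz⟩ => absurd hz (not_le.2 (hstrong v hv z))
    rw [K.state_king (r := r + 2) (by omega) hv, K.reliable _ _ hv _ hking, h2]
    simp

theorem AllHold.mono {K : KingRun k t d H c king} {p q : ℕ} (hpq : p ≤ q) {v : V}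
    (h : K.AllHold (3 * p + 1) v) : K.AllHold (3 * q + 1) v := by
  induction q, hpq using Nat.le_induction with
  | base => exact h
  | succ q _ ih => exact ih.phase (by omega)

theorem allHold_of_source (hflag : ∀ u ∈ H, (K.state 0 u).2 = false) (hsrc : king 0 ∈ H) {v : V}
    (hv : (K.state 0 (king 0)).1 = some v) (q : ℕ) : K.AllHold (3 * q + 1) v := by
  refine AllHold.mono (p := 0) (Nat.zero_le q) fun u hu => ?_
  rw [K.state_king (r := 0) rfl hu, K.reliable _ _ hu _ hsrc, hflag u hu, hv]
  simp

/-- As `t < k`, some core party is honest; the phase in which it is king creates a common value,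
which then persists. -/
theorem exists_allHold (hking : ∀ i : Fin k, king (3 * (i + 1)) = c i) :
    ∃ v, K.AllHold (3 * k + 1) v := by
  have := K.resilience
  obtain ⟨i, -, hi⟩ := K.exists_honest_of_lt_ncard (S := Set.univ) (by
    rw [Set.ncard_univ, Nat.card_eq_fintype_card, Fintype.card_fin]; omega)
  obtain ⟨v, hv⟩ := K.exists_allHold_of_king (r := 3 * i + 1) (by omega)
    (by rw [show 3 * (i : ℕ) + 1 + 2 = 3 * (i + 1) by ring, hking]; exact hi)
  exact ⟨v, AllHold.mono (p := i + 1) i.2 hv⟩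

end KingRun

/-! ### Simulating a complete network by relays in `R`. -/

/-- A synchronous algorithm for a complete network with reliable broadcast channels. It stops after
`rounds` rounds. -/
structure BroadcastAlgorithm (k : ℕ) where
  Msg : Type
  State : Type
  defaultMsg : Msg
  init : (u : Party k) → PrefList u → State
  send : State → Msg
  step : ℕ → State → (Party k → Msg) → State
  rounds : ℕ
  output : (u : Party k) → State → Option (Partner u)

open Classical in
/-- The value taken by `f` on more than half of its arguments, if there is one. -/
noncomputable def majorityValue {k : ℕ} {M : Type} (d : M) (f : Fin k → M) : M :=
  if h : ∃ m, k < 2 * {j | f j = m}.ncard then h.choose else d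

theorem majorityValue_eq {k : ℕ} {M : Type} {d m : M} {f : Fin k → M}
    (hm : k < 2 * {j | f j = m}.ncard) : majorityValue d f = m := by
  have h : ∃ m, k < 2 * {j | f j = m}.ncard := ⟨m, hm⟩
  unfold majorityValue
  rw [dif_pos h]
  have h1 := h.choose_spec
  have h2 := Set.ncard_union_add_ncard_inter {j | f j = h.choose} {j | f j = m}
  have h3 := Set.ncard_le_card ({j | f j = h.choose} ∪ {j | f j = m})
  rw [Nat.card_eq_fintype_card, Fintype.card_fin] at h3
  obtain ⟨j, hj, hj'⟩ : ({j | f j = h.choose} ∩ {j | f j = m}).Nonempty := by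
    rw [← Set.ncard_pos]
    omega
  exact (show f j = h.choose from hj).symm.trans hj'

namespace BroadcastAlgorithm

variable {k : ℕ} (B : BroadcastAlgorithm k)

/-- A local state of the relayed algorithm: the number of past rounds, the local state of `B`, and
the broadcasts that are to be relayed. -/
abbrev RelayState : Type := ℕ × B.State × (Party k → B.Msg)

def relaySend (s : B.RelayState) : Party k → B.Msg :=
  if s.1 % 2 = 0 then fun _ => B.send s.2.1 else s.2.2

/-- The messages received by `u`, including the one that it would send to itself. -/
def relayInbox (u : Party k) (s : B.RelayState) (rcv : Party k → Option (Party k → B.Msg)) :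
    Party k → Party k → B.Msg :=
  fun v => if v = u then B.relaySend s else (rcv v).getD fun _ => B.defaultMsg

/-- The broadcasts as reported by the majority of the relays in `R`. -/
noncomputable def relayedBroadcasts (inbox : Party k → Party k → B.Msg) : Party k → B.Msg :=
  fun v => majorityValue B.defaultMsg fun j : Fin k => inbox (Sum.inr j) v

/-- Every broadcast of `B` takes two rounds: first it is sent to the parties of `R`, who
then relay it to everyone. -/
noncomputable def protocol : Protocol k where
  Msg := Party k → B.Msg
  State := B.RelayState
  init u π := (0, B.init u π, fun _ => B.defaultMsg)
  send _ s _ := some (B.relaySend s)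
  step u s rcv :=
    if s.1 % 2 = 0 then (s.1 + 1, s.2.1, fun v => B.relayInbox u s rcv v v)
    else (s.1 + 1, B.step (s.1 / 2) s.2.1 (B.relayedBroadcasts (B.relayInbox u s rcv)), s.2.2)
  output u s := if s.1 = 2 * B.rounds then some (B.output u s.2.1) else none

variable {B} (E : Execution B.protocol (oneSidedNetwork k))

/-- The local state of `u` at the beginning of round `r`. -/
noncomputable def relayState (r : ℕ) (u : Party k) : B.RelayState :=
  B.protocol.state E.msg u (E.input u) r

/-- The messages that `u` receives in round `r`. -/
noncomputable def inboxAt (r : ℕ) (u : Party k) : Party k → Party k → B.Msg :=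
  B.relayInbox u (relayState E r u) fun v => E.msg r v u

/-- The broadcasts that `u` receives in round `r` of the simulated algorithm. -/
noncomputable def receivedAt (r : ℕ) (u : Party k) : Party k → B.Msg :=
  B.relayedBroadcasts (inboxAt E (2 * r + 1) u)

/-- The local state of `u` at the beginning of round `r` of the simulated algorithm. -/
noncomputable def simulatedState (r : ℕ) (u : Party k) : B.State := (relayState E (2 * r) u).2.1

theorem relayState_succ (r : ℕ) (u : Party k) : relayState E (r + 1) u =
    if (relayState E r u).1 % 2 = 0 then ((relayState E r u).1 + 1, (relayState E r u).2.1,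
      fun v => inboxAt E r u v v)
    else ((relayState E r u).1 + 1, B.step ((relayState E r u).1 / 2) (relayState E r u).2.1
      (B.relayedBroadcasts (inboxAt E r u)), (relayState E r u).2.2) := rfl

theorem relayState_fst (r : ℕ) (u : Party k) : (relayState E r u).1 = r := by
  induction r with
  | zero => rfl
  | succ r ih =>
    rw [relayState_succ]
    split_ifs <;> simp [ih]

theorem relayState_two_mul_add_one (r : ℕ) (u : Party k) : relayState E (2 * r + 1) u =
    (2 * r + 1, simulatedState E r u, fun v => inboxAt E (2 * r) u v v) := by
  rw [relayState_succ, relayState_fst, if_pos (by omega)]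
  rfl

theorem simulatedState_succ (r : ℕ) (u : Party k) : simulatedState E (r + 1) u =
    B.step r (simulatedState E r u) (receivedAt E r u) := by
  rw [simulatedState, show 2 * (r + 1) = 2 * r + 1 + 1 by ring, relayState_succ, relayState_fst,
    if_neg (by omega), relayState_two_mul_add_one, show (2 * r + 1) / 2 = r by omega]
  rfl

theorem inboxAt_eq {r : ℕ} {u v : Party k} (hv : E.Honest v)
    (huv : u.isLeft = false ∨ v.isLeft = false) :
    inboxAt E r u v = B.relaySend (relayState E r v) := by
  unfold inboxAt relayInbox
  split_ifs with h
  · rw [h]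
  · have hmsg : E.msg r v u = some (B.relaySend (relayState E r v)) :=
      E.follows r v u (by rw [show E.corruptedAt v = ⊤ from hv]; exact ENat.natCast_lt_top r)
        ⟨h, by rcases huv with h' | h' <;> simp [h']⟩
    exact congrArg (fun o : Option (Party k → B.Msg) => o.getD fun _ => B.defaultMsg) hmsg

/-- If the honest parties form a majority of `R`, they simulate a complete network. -/
theorem receivedAt_eq {tR : ℕ} (htR : 2 * tR < k)
    (hR : {j : Fin k | ¬ E.Honest (Sum.inr j)}.ncard ≤ tR) (r : ℕ) (u : Party k) {v : Party k}
    (hv : E.Honest v) : receivedAt E r u v = B.send (simulatedState E r v) := by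
  -- Each honest relay has a channel to every other party, so it receives the broadcast of `v` and
  -- passes it on to `u` unchanged; these relays number at least `k - tR > k / 2`.
  refine majorityValue_eq ?_
  have hsub : {j : Fin k | ¬ E.Honest (Sum.inr j)}ᶜ ⊆
      {j | inboxAt E (2 * r + 1) u (Sum.inr j) v = B.send (simulatedState E r v)} := by
    intro j hj
    have hj' : E.Honest (Sum.inr j) := by simpa using hj
    change inboxAt E (2 * r + 1) u (Sum.inr j) v = _
    rw [inboxAt_eq E hj' (Or.inr rfl), relayState_two_mul_add_one, relaySend, if_neg (by
      simp only; omega)]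
    simp only
    rw [inboxAt_eq E hv (Or.inl rfl), relaySend, if_pos (by rw [relayState_fst]; omega)]
    rfl
  have h1 := Set.ncard_le_ncard hsub
  have h2 := Set.ncard_add_ncard_compl {j : Fin k | ¬ E.Honest (Sum.inr j)}
  rw [Nat.card_eq_fintype_card, Fintype.card_fin] at h2
  omega

theorem outputs_iff (u : Party k) (o : Option (Partner u)) :
    E.Outputs u o ↔ o = B.output u (simulatedState E B.rounds u) := by
  have key : ∀ r, B.protocol.output u (B.protocol.state E.msg u (E.input u) r) =
      if r = 2 * B.rounds then some (B.output u (relayState E r u).2.1) else none := by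
    intro r
    change (if (relayState E r u).1 = 2 * B.rounds then _ else _) = _
    rw [relayState_fst]
    rfl
  constructor
  · rintro ⟨r, hr, -⟩
    rw [key] at hr
    split_ifs at hr with h
    subst h
    exact (Option.some_injective _ hr).symm
  · rintro rfl
    refine ⟨2 * B.rounds, by rw [key, if_pos rfl]; rfl, fun r hr => ?_⟩
    rw [key, if_neg hr.ne]

end BroadcastAlgorithm

/-! ### The stable matching of a profile. -/

/-- The rankings of `R` by the parties of `L`. -/
def leftRanking {k : ℕ} (x : (u : Party k) → PrefList u) (i : Fin k) : Fin k ≃ Fin k :=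
  (x (Sum.inl i)).trans (rightPartner i).symm

/-- The rankings of `L` by the parties of `R`. -/
def rightRanking {k : ℕ} (x : (u : Party k) → PrefList u) (j : Fin k) : Fin k ≃ Fin k :=
  (x (Sum.inr j)).trans (leftPartner j).symm

/-- A stable matching for the preference lists `x`. -/
noncomputable def stableMatching {k : ℕ} (x : (u : Party k) → PrefList u) : Fin k ≃ Fin k :=
  (exists_stable_matching (leftRanking x) (rightRanking x)).choose

noncomputable def stablePartner {k : ℕ} (x : (u : Party k) → PrefList u) :
    (u : Party k) → Partner u
  | Sum.inl i => rightPartner i (stableMatching x i)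
  | Sum.inr j => leftPartner j ((stableMatching x).symm j)

theorem stablePartner_symm {k : ℕ} (x : (u : Party k) → PrefList u) {u v : Party k}
    (h : OppositeSides u v) (huv : stablePartner x u = ⟨v, h⟩) :
    stablePartner x v = ⟨u, h.symm⟩ := by
  have huv' := congrArg Subtype.val huv
  apply Subtype.ext
  rcases u with i | i <;> rcases v with j | j
  · simp [OppositeSides] at h
  · have hm : stableMatching x i = j := Sum.inr_injective huv'
    change Sum.inl ((stableMatching x).symm j) = Sum.inl i
    rw [← hm, Equiv.symm_apply_apply]
  · have hm : (stableMatching x).symm i = j := Sum.inl_injective huv'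
    change Sum.inr (stableMatching x j) = Sum.inr i
    rw [← hm, Equiv.apply_symm_apply]
  · simp [OppositeSides] at h

theorem stablePartner_injective {k : ℕ} (x : (u : Party k) → PrefList u) {u v : Party k}
    (h : (stablePartner x u : Party k) = stablePartner x v) : u = v := by
  have hu := congrArg Subtype.val (stablePartner_symm x (stablePartner x u).2 rfl)
  have hv := congrArg Subtype.val (stablePartner_symm x (stablePartner x v).2 rfl)
  have key : ∀ w w' : Party k, w = w' →
      (stablePartner x w : Party k) = stablePartner x w' := by rintro w _ rfl; rfl
  exact hu.symm.trans ((key _ _ h).trans hv)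

theorem stablePartner_stable {k : ℕ} (x : (u : Party k) → PrefList u) {u v : Party k}
    (h : OppositeSides u v) :
    ¬ (Prefers (x u) ⟨v, h⟩ (some (stablePartner x u)) ∧
      Prefers (x v) ⟨u, h.symm⟩ (some (stablePartner x v))) := by
  have hst := (exists_stable_matching (leftRanking x) (rightRanking x)).choose_spec
  rcases u with i | i <;> rcases v with j | j
  · simp [OppositeSides] at h
  · exact hst i j
  · exact fun hp => hst j i hp.symm
  · simp [OppositeSides] at h

/-! ### The matching protocol and its correctness. -/

section Protocol

variable {k : ℕ}

/-- The kings of the agreement on the input of the party `w`: first `w` itself, then in turn the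
core parties `c i`. -/
def kingOf (c : Fin k → Party k) (w : Party k) (r : ℕ) : Party k :=
  -- The king of round `3 * (i + 1)` is `c i`. Truncated subtraction gives a king to rounds `1` and
  -- `2` too, but only rounds divisible by 3 consult it.
  if h : 0 < r ∧ r / 3 - 1 < k then c ⟨r / 3 - 1, h.2⟩ else w

/-- The parties agree on all inputs by phase king algorithms, up to `t` of whose core parties `c i`
may be byzantine, and choose a stable matching. -/
noncomputable def matchingAlgorithm (c : Fin k → Party k) (t : ℕ) : BroadcastAlgorithm k where
  Msg := (w : Party k) → Option (PrefList w)
  State := (w : Party k) → KingState (PrefList w)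
  defaultMsg _ := none
  init u π := Function.update (fun _ => (none, false)) u (some π, false)
  send s w := (s w).1
  step r s rcv w := kingStep k t (defaultPref w) r (s w) (rcv (kingOf c w r) w)
    (fun i => rcv (c i) w)
  -- The source round `0`, then one phase of three rounds for each core party.
  rounds := 3 * k + 1
  output u s := some (stablePartner (fun w => (s w).1.getD (defaultPref w)) u)

open BroadcastAlgorithm

variable {c : Fin k → Party k} {t tR : ℕ}
  (E : Execution (matchingAlgorithm c t).protocol (oneSidedNetwork k))

/-- The phase king algorithm for the input of `w` within an execution of the whole protocol. -/
noncomputable def kingRun (htR : 2 * tR < k)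
    (hR : {j : Fin k | ¬ E.Honest (Sum.inr j)}.ncard ≤ tR) (ht : 3 * t < k)
    (hc : {i | ¬ E.Honest (c i)}.ncard ≤ t) (w : Party k) :
    KingRun k t (defaultPref w) {u | E.Honest u} c (kingOf c w) where
  state r u := simulatedState E r u w
  received r u v := receivedAt E r u v w
  update r u _ := congrFun (simulatedState_succ E r u) w
  reliable r u _ _ hv := congrFun (receivedAt_eq E htR hR r u hv) w
  few_faults := hc
  resilience := ht

/-- For honest `w`, round `0` already spreads its input and the phases preserve it; for byzantine
`w`, an honest king forces agreement on some list. -/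
theorem exists_agreed_profile (htR : 2 * tR < k)
    (hR : {j : Fin k | ¬ E.Honest (Sum.inr j)}.ncard ≤ tR) (ht : 3 * t < k)
    (hc : {i | ¬ E.Honest (c i)}.ncard ≤ t) :
    ∃ x : (w : Party k) → PrefList w, (∀ w, E.Honest w → x w = E.input w) ∧
      ∀ u, E.Honest u → ∀ w, (simulatedState E (3 * k + 1) u w).1 = some (x w) := by
  have hinit : ∀ u, simulatedState E 0 u =
      Function.update (fun _ => (none, false)) u (some (E.input u), false) := fun _ => rfl
  have key : ∀ w, ∃ π : PrefList w, (E.Honest w → π = E.input w) ∧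
      ∀ u, E.Honest u → (simulatedState E (3 * k + 1) u w).1 = some π := by
    intro w
    let K := kingRun E htR hR ht hc w
    have hking : kingOf c w 0 = w := by simp [kingOf]
    by_cases hw : E.Honest w
    · refine ⟨E.input w, fun _ => rfl, K.allHold_of_source (fun u _ => ?_) ?_ ?_ k⟩
      · change (simulatedState E 0 u w).2 = false
        rw [hinit]
        by_cases h : w = u
        · subst h; simp
        · simp [Function.update_of_ne h]
      · rw [hking]; exact hw
      · change (simulatedState E 0 (kingOf c w 0) w).1 = _
        rw [hking, hinit]
        simp
    · obtain ⟨π, hπ⟩ := K.exists_allHold (fun i => by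
        have hi : (3 * ((i : ℕ) + 1)) / 3 - 1 = i := by omega
        simp [kingOf])
      exact ⟨π, fun h => absurd h hw, hπ⟩
  choose x hx using key
  exact ⟨x, fun w => (hx w).1, fun u hu w => (hx w).2 u hu⟩

theorem matchingAlgorithm_correct (htR : 2 * tR < k)
    (hR : {j : Fin k | ¬ E.Honest (Sum.inr j)}.ncard ≤ tR) (ht : 3 * t < k)
    (hc : {i | ¬ E.Honest (c i)}.ncard ≤ t) :
    E.Termination ∧ E.Symmetry ∧ E.Stability ∧ E.NonCompetition := by
  obtain ⟨x, hx, hagree⟩ := exists_agreed_profile E htR hR ht hc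
  have hout : ∀ u, E.Honest u → ∀ o, E.Outputs u o ↔ o = some (stablePartner x u) := by
    intro u hu o
    rw [outputs_iff]
    have hprof : (fun w => ((simulatedState E (3 * k + 1) u w).1).getD (defaultPref w)) = x :=
      funext fun w => by rw [hagree u hu w, Option.getD_some]
    change o = some (stablePartner
      (fun w => ((simulatedState E (3 * k + 1) u w).1).getD (defaultPref w)) u) ↔ _
    rw [hprof]
  refine ⟨fun u hu => ⟨_, (hout u hu _).2 rfl⟩, ?_, ?_, ?_⟩
  · intro u v h hu hv ho
    rw [hout u hu] at ho
    rw [hout v hv, stablePartner_symm x h (Option.some_injective _ ho).symm]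
  · intro u v h hu hv o o' ho ho'
    rw [hout u hu] at ho
    rw [hout v hv] at ho'
    rw [ho, ho', ← hx u hu, ← hx v hv]
    exact stablePartner_stable x h
  · intro u v huv hu hv y z hy hz hyz
    rw [hout u hu] at hy
    rw [hout v hv] at hz
    obtain rfl := Option.some_injective _ hy
    obtain rfl := Option.some_injective _ hz
    exact huv (stablePartner_injective x hyz)

end Protocol

theorem solvable_of_bounds {k tL tR : ℕ} {A : Adversary} (h2 : 2 * tR < k)
    (h3 : 3 * tL < k ∨ 3 * tR < k) : BSMSolvable (oneSidedNetwork k) A tL tR := by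
  rcases h3 with h3 | h3
  · exact ⟨(matchingAlgorithm Sum.inl tL).protocol,
      fun E hE => matchingAlgorithm_correct E h2 hE.2.1 h3 hE.1⟩
  · exact ⟨(matchingAlgorithm Sum.inr tR).protocol,
      fun E hE => matchingAlgorithm_correct E h2 hE.2.1 h3 hE.2.1⟩

end ByzantineSM

theorem mainTheorem3 (k tL tR : ℕ) (hk : 2 ≤ k) (A : ByzantineSM.Adversary) :
    ByzantineSM.BSMSolvable (ByzantineSM.oneSidedNetwork k) A tL tR ↔
      (tR : ℝ) < (k : ℝ) / 2 ∧ ((tL : ℝ) < (k : ℝ) / 3 ∨ (tR : ℝ) < (k : ℝ) / 3) := by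
  have h2 : (tR : ℝ) < (k : ℝ) / 2 ↔ 2 * tR < k := by
    rw [lt_div_iff₀ (by norm_num), mul_comm]; exact_mod_cast Iff.rfl
  have h3 : ∀ t : ℕ, (t : ℝ) < (k : ℝ) / 3 ↔ 3 * t < k := fun t => by
    rw [lt_div_iff₀ (by norm_num), mul_comm]; exact_mod_cast Iff.rfl
  rw [h2, h3, h3]
  refine ⟨fun h => ?_, fun h => ByzantineSM.solvable_of_bounds h.1 h.2⟩
  have hR : 2 * tR < k := by
    by_contra hcon
    exact ByzantineSM.not_solvable_of_le_two_mul hk (not_lt.1 hcon) h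
  refine ⟨hR, ?_⟩
  by_contra! hcon
  -- Here `3 ≤ k`, because `k = 2` and `2 * tR < k` would give `tR = 0`, against `k ≤ 3 * tR`.
  exact ByzantineSM.not_solvable_of_le_three_mul (by omega) hcon.1 hcon.2 h
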